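/- Let $D$ be an oriented diagram on the sphere, with $N\ge 1$ crossings $c_1,\dots,c_N$, of an oriented knot $K$. Let $G_K$ be the knot group, given by the Wirtinger presentation of $D$: one generator $m_\alpha$ for each arc $\alpha$, and at a crossing with incoming under-arc $i$, outgoing under-arc $j$ and over-arc $k$ the relation $m_j=m_k^{-1}m_im_k$ if the crossing is positive and $m_j=m_km_im_k^{-1}$ if it is negative. A homomorphism $\rho:G_K\to SL(2,\mathbb C)$ is \emph{parabolic} if its image is non-abelian and $\operatorname{tr}\rho(m)=2$, $\rho(m)\ne I$ for every meridian $m$. The \emph{obstruction class} of a parabolic $\rho$ is $\mathrm{ob}(\rho)=\tfrac12\operatorname{tr}\rho(\ell)$, where $\ell$ is the preferred longitude. For $v=\binom xy\in\mathbb C^2$ put $M(v)=\begin{pmatrix}1-xy&x^2\\-y^2&1+xy\end{pmatrix}$, and for $a,b\in\mathbb C^2$ put $a\triangleright b=M(b)^{-1}a$ and $a\triangleleft b=M(b)a$. A \emph{sign-type} is $\varepsilon=(\varepsilon_1,\dots,\varepsilon_N)\in\{\pm1\}^N$; its \emph{total sign} is $[\varepsilon]=\varepsilon_1\cdots\varepsilon_N$.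 An \emph{arc-coloring} $a$ of $D$ assigns a vector of $\mathbb C^2$ to each arc such that at each crossing $c_n$, with arcs $i,j,k$ as above, $\pm a_j=a_i\triangleright a_k$ if $c_n$ is positive and $\pm a_j=a_i\triangleleft a_k$ if it is negative, for some choice of the sign. It has the associated representation $\rho_a$ with $\rho_a(m_\alpha)=M(a_\alpha)$. Let $\mathcal Q_\varepsilon$, the set of \emph{arc-colorings of sign-type} $\varepsilon$, be the set of the arc-colorings $a$ with $\rho_a$ parabolic that satisfy $\varepsilon_na_j=a_i\triangleright a_k$ (positive crossing), $\varepsilon_na_j=a_i\triangleleft a_k$ (negative crossing) at every $c_n$. Then: 1. For every parabolic $\rho$, $\mathrm{ob}(\rho)\in\{\pm1\}$, and $\operatorname{tr}\rho(\ell)=2\,\mathrm{ob}(\rho)$ for every longitude $\ell$ of $K$ (of any framing). 2. Let $\rho$ be parabolic of obstruction class $\lambda\in\{\pm1\}$. For every sign-type $\varepsilon$ with $[\varepsilon]=\lambda$ there is an arc-coloring $a\in\mathcal Q_\varepsilon$ with $\rho_a=\rho$. Moreover $a\neq-a$, and the arc-colorings of sign-type $\varepsilon$ whose associated representation is $\rho$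 are exactly $a$ and $-a$. 3. If $a\in\mathcal Q_\varepsilon$, then $\mathrm{ob}(\rho_a)=[\varepsilon]$. 4. Each $\mathcal Q_\varepsilon$ is preserved by the action $(Ba)_\alpha=B\,a_\alpha$ of $B\in SL(2,\mathbb C)$. Fix sign-types $\varepsilon_+$ and $\varepsilon_-$ with $[\varepsilon_+]=1$ and $[\varepsilon_-]=-1$. Then $\mathcal Q_{\varepsilon_+}$ and $\mathcal Q_{\varepsilon_-}$ are disjoint, and $a\mapsto\rho_a$ induces a well-defined bijection $$(\mathcal Q_{\varepsilon_+}\sqcup\mathcal Q_{\varepsilon_-})/SL(2,\mathbb C)\longrightarrow X_{par},$$ where $X_{par}$ is the set of conjugacy classes of parabolic representations $G_K\to SL(2,\mathbb C)$. The same holds with $X_{par}$ replaced by the set of characters of parabolic representations. -/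

import Mathlib

open scoped MatrixGroups

/-- A signed Gauss code with `N` crossings. A point runs once around the oriented knot and meets
`2 N` passages, numbered cyclically by `ZMod (2 * N)`. The passage `p` is through the crossing
`(visit p).1`, on the over-strand if `(visit p).2 = true` and on the under-strand if
`(visit p).2 = false`. (There is no such code with `N = 0`.) -/
structure SignedGaussCode (N : ℕ) where
  visit : ZMod (2 * N) ≃ Fin N × Bool
  sign : Fin N → ℤˣ

namespace SignedGaussCode

variable {N : ℕ} (D : SignedGaussCode N)

/-- The passage over the crossing `c`. -/
def overPassage (c : Fin N) : ZMod (2 * N) := D.visit.symm (c, true)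

/-- The passage under the crossing `c`. -/
def underPassage (c : Fin N) : ZMod (2 * N) := D.visit.symm (c, false)

/-! Planarity. The edge `p` of the underlying 4-valent graph runs from passage `p` to passage
`p + 1`. A half-edge `(p, out)` is the outgoing half-edge at passage `p` (`out = true`, the
beginning of edge `p`) or the incoming one (`out = false`, the end of edge `p - 1`). -/

/-- The other half of the same edge. -/
def acrossEdge : ZMod (2 * N) × Bool → ZMod (2 * N) × Bool
  | (p, true) => (p + 1, false)
  | (p, false) => (p - 1, true)

/-- The next half-edge counterclockwise around the same crossing. The counterclockwise order is
over-out, under-out, over-in, under-in at a positive crossing, and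
over-out, under-in, over-in, under-out at a negative crossing. -/
def rotate (h : ZMod (2 * N) × Bool) : ZMod (2 * N) × Bool :=
  let c := (D.visit h.1).1
  if (D.visit h.1).2 = true then
    (D.underPassage c, if D.sign c = 1 then h.2 else !h.2)
  else
    (D.overPassage c, if D.sign c = 1 then !h.2 else h.2)

/-- The faces of the closed oriented surface obtained by gluing discs to the 4-valent ribbon graph
of the code: the cycles of the permutation "go along the edge, then rotate". -/
def Face : Type := Quot fun h h' : ZMod (2 * N) × Bool => h' = D.rotate (acrossEdge h)

end SignedGaussCode

/-- An oriented knot diagram on the sphere with `N` crossings: a signed Gauss code whose surface has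
Euler characteristic `N - 2 N + #faces = 2`. -/
structure KnotDiagram (N : ℕ) extends SignedGaussCode N where
  planar : Nat.card toSignedGaussCode.Face = N + 2

/-- The quandle map `(x, y) ↦ [[1 - xy, x²], [-y², 1 + xy]]` into `SL(2, ℂ)`. -/
def quandleMap (v : Fin 2 → ℂ) : SL(2, ℂ) :=
  ⟨!![1 - v 0 * v 1, v 0 ^ 2; -(v 1) ^ 2, 1 + v 0 * v 1], by
    rw [Matrix.det_fin_two_of]; ring⟩

/-- `a ▷ b = M(b)⁻¹ a`. -/
def quandleRight (a b : Fin 2 → ℂ) : Fin 2 → ℂ := ((quandleMap b)⁻¹ : SL(2, ℂ)).1.mulVec a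

/-- `a ◁ b = M(b) a`. -/
def quandleLeft (a b : Fin 2 → ℂ) : Fin 2 → ℂ := (quandleMap b).1.mulVec a

/-- Equivariance of the quandle map. -/
theorem quandleMap_mulVec (B : SL(2, ℂ)) (v : Fin 2 → ℂ) :
    quandleMap (B.1.mulVec v) = B * quandleMap v * B⁻¹ := by
  have hd : B.1 0 0 * B.1 1 1 - B.1 0 1 * B.1 1 0 = 1 := by
    rw [← Matrix.det_fin_two]; exact B.2
  rw [eq_mul_inv_iff_mul_eq]
  ext i j
  rw [Matrix.SpecialLinearGroup.coe_mul, Matrix.SpecialLinearGroup.coe_mul]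
  fin_cases i <;> fin_cases j <;>
    simp [quandleMap, Matrix.mul_apply, Matrix.mulVec, dotProduct, Fin.sum_univ_two] <;>
    grind

theorem quandleMap_unit_smul (s : ℤˣ) (v : Fin 2 → ℂ) : quandleMap (s • v) = quandleMap v := by
  rcases Int.units_eq_one_or s with rfl | rfl
  · simp
  · ext i j
    fin_cases i <;> fin_cases j <;> simp [quandleMap]

/-- The total sign `ε₁ ⋯ ε_N` of a sign-type. -/
def totalSign {N : ℕ} (ε : Fin N → ℤˣ) : ℤˣ := ∏ c, ε c

namespace SignedGaussCode

variable {N : ℕ} (D : SignedGaussCode N)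

/-- The arcs: the edges `t - 1` and `t` belong to the same arc if the passage `t` between them is an
over-passage. -/
def Arc : Type :=
  Quot fun s t : ZMod (2 * N) => t = s + 1 ∧ (D.visit t).2 = true

/-- The arc containing the edge from passage `t` to passage `t + 1`. -/
def arcOfEdge (t : ZMod (2 * N)) : D.Arc := Quot.mk _ t

/-- The arc that ends at the under-passage of the crossing `c`. -/
def arcIn (c : Fin N) : D.Arc := D.arcOfEdge (D.underPassage c - 1)

/-- The arc that starts at the under-passage of the crossing `c`. -/
def arcOut (c : Fin N) : D.Arc := D.arcOfEdge (D.underPassage c)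

/-- The arc that passes over the crossing `c`. -/
def arcOver (c : Fin N) : D.Arc := D.arcOfEdge (D.overPassage c)

/-- The Wirtinger relator at a crossing with incoming arc `i`, outgoing arc `j` and over-arc `k`:
`j⁻¹ k⁻¹ i k` at a positive crossing, `j⁻¹ k i k⁻¹` at a negative one. -/
def relator (c : Fin N) : FreeGroup D.Arc :=
  let i := FreeGroup.of (D.arcIn c)
  let j := FreeGroup.of (D.arcOut c)
  let k := FreeGroup.of (D.arcOver c)
  if D.sign c = 1 then j⁻¹ * k⁻¹ * i * k else j⁻¹ * k * i * k⁻¹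

/-- The knot group, through its Wirtinger presentation. -/
abbrev KnotGroup : Type := PresentedGroup (Set.range D.relator)

/-- The Wirtinger generator of an arc. -/
def wirtinger (i : D.Arc) : D.KnotGroup := PresentedGroup.of i

/-- The meridians: conjugates of Wirtinger generators and of their inverses. -/
def IsMeridian (g : D.KnotGroup) : Prop :=
  ∃ i, IsConj (D.wirtinger i) g ∨ IsConj (D.wirtinger i)⁻¹ g

/-- The contribution of a passage to the blackboard-framed longitude: the Wirtinger generator of the
over-arc to the power of the crossing sign at an under-passage, nothing at an over-passage. -/
def longitudeFactor (p : ZMod (2 * N)) : D.KnotGroup :=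
  let c := (D.visit p).1
  if (D.visit p).2 = true then 1 else D.wirtinger (D.arcOver c) ^ ((D.sign c : ℤˣ) : ℤ)

/-- The blackboard-framed longitude, starting on the edge `0` and running through the passages
`1, 2, …, 2 N`. -/
def blackboardLongitude : D.KnotGroup :=
  ((List.range (2 * N)).map fun r => D.longitudeFactor ((r + 1 : ℕ) : ZMod (2 * N))).prod

/-- The writhe of the diagram. -/
def writhe : ℤ := ∑ c, ((D.sign c : ℤˣ) : ℤ)

/-- The longitudes, of all framings and up to conjugation. -/
def IsLongitude (g : D.KnotGroup) : Prop :=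
  ∃ k : ℤ, IsConj (D.blackboardLongitude * D.wirtinger (D.arcOfEdge 0) ^ k) g

/-- The preferred (null-homologous) longitude. -/
def preferredLongitude : D.KnotGroup :=
  D.blackboardLongitude * D.wirtinger (D.arcOfEdge 0) ^ (-D.writhe)

/-- A parabolic representation: non-abelian, and every meridian goes to a matrix of trace `2` other
than the identity. -/
def IsParabolic (ρ : D.KnotGroup →* SL(2, ℂ)) : Prop :=
  (∃ g h, ρ g * ρ h ≠ ρ h * ρ g) ∧ ∀ m, D.IsMeridian m → (ρ m).1.trace = 2 ∧ ρ m ≠ 1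

/-- The set of parabolic representations. -/
def ParRep : Type := {ρ : D.KnotGroup →* SL(2, ℂ) // D.IsParabolic ρ}

/-- The obstruction class: half the trace of the longitude. -/
noncomputable def obstructionClass (ρ : D.KnotGroup →* SL(2, ℂ)) : ℂ :=
  (ρ D.preferredLongitude).1.trace / 2

/-- Conjugacy of parabolic representations. -/
def conjSetoid : Setoid D.ParRep where
  r ρ ρ' := ∃ A : SL(2, ℂ), ∀ g, ρ'.1 g = A * ρ.1 g * A⁻¹
  iseqv :=
    { refl := fun ρ => ⟨1, fun g => by simp⟩
      symm := fun ⟨A, h⟩ => ⟨A⁻¹, fun g => by rw [h]; group⟩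
      trans := fun ⟨A, h⟩ ⟨B, h'⟩ => ⟨B * A, fun g => by rw [h', h]; group⟩ }

/-- Equality of the characters of parabolic representations. -/
def charSetoid : Setoid D.ParRep where
  r ρ ρ' := ∀ g, (ρ.1 g).1.trace = (ρ'.1 g).1.trace
  iseqv :=
    { refl := fun _ _ => rfl
      symm := fun h g => (h g).symm
      trans := fun h h' g => (h g).trans (h' g) }

/-- The conjugacy classes of parabolic representations. -/
def ConjClassesPar : Type := Quotient D.conjSetoid

/-- The characters of parabolic representations. -/
def CharsPar : Type := Quotient D.charSetoid

/-- The quandle relation of sign `s` at the crossing `c` for the vectors `a` on the arcs: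
`s a_j = a_i ▷ a_k` at a positive crossing, `s a_j = a_i ◁ a_k` at a negative one. -/
def QuandleRel (a : D.Arc → Fin 2 → ℂ) (c : Fin N) (s : ℤˣ) : Prop :=
  s • a (D.arcOut c) =
    if D.sign c = 1 then quandleRight (a (D.arcIn c)) (a (D.arcOver c))
    else quandleLeft (a (D.arcIn c)) (a (D.arcOver c))

/-- The arc-colorings that satisfy the quandle relations up to sign. -/
def quandleSystemStar : Set (D.Arc → Fin 2 → ℂ) :=
  {a | ∀ c, ∃ s : ℤˣ, D.QuandleRel a c s}

theorem lift_relator_eq_one {a : D.Arc → Fin 2 → ℂ} (ha : a ∈ D.quandleSystemStar) :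
    ∀ r ∈ Set.range D.relator, FreeGroup.lift (fun i => quandleMap (a i)) r = 1 := by
  rintro _ ⟨c, rfl⟩
  obtain ⟨s, hs⟩ := ha c
  have h := congrArg quandleMap hs
  rw [quandleMap_unit_smul] at h
  by_cases hc : D.sign c = 1
  · simp only [hc, if_true, quandleRight, quandleMap_mulVec] at h
    simp only [relator, hc, if_true, map_mul, map_inv, FreeGroup.lift_apply_of, h]
    group
  · simp only [hc, if_false, quandleLeft, quandleMap_mulVec] at h
    simp only [relator, hc, if_false, map_mul, map_inv, FreeGroup.lift_apply_of, h]
    group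

/-- The representation associated with an arc-coloring: `ρ_a (wirtinger i) = M(a_i)`. -/
def assocRep (a : D.Arc → Fin 2 → ℂ) (ha : a ∈ D.quandleSystemStar) :
    D.KnotGroup →* SL(2, ℂ) :=
  PresentedGroup.toGroup (D.lift_relator_eq_one ha)

/-- The parabolic quandle system (with sign-ambiguity): the arc-colorings whose associated
representation is parabolic. -/
def quandleSystem : Set (D.Arc → Fin 2 → ℂ) :=
  {a | ∃ ha : a ∈ D.quandleSystemStar, D.IsParabolic (D.assocRep a ha)}

/-- The parabolic quandle system of sign-type `ε`. -/
def signedQuandleSystem (ε : Fin N → ℤˣ) : Set (D.Arc → Fin 2 → ℂ) :=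
  {a | a ∈ D.quandleSystem ∧ ∀ c, D.QuandleRel a c (ε c)}

theorem union_subset_quandleSystem (ε₁ ε₂ : Fin N → ℤˣ) :
    D.signedQuandleSystem ε₁ ∪ D.signedQuandleSystem ε₂ ⊆ D.quandleSystem :=
  Set.union_subset (fun _ h => h.1) (fun _ h => h.1)

/-- The parabolic representation of an element of the quandle system. -/
def parRep (a : D.Arc → Fin 2 → ℂ) (ha : a ∈ D.quandleSystem) : D.ParRep :=
  ⟨D.assocRep a ha.1, ha.2⟩

/-- Left multiplication of all coloring vectors by a matrix. -/
def leftMul (B : SL(2, ℂ)) (a : D.Arc → Fin 2 → ℂ) : D.Arc → Fin 2 → ℂ :=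
  fun i => B.1.mulVec (a i)

/-- The equivalence relation of the left `SL(2, ℂ)`-action on a set of arc-colorings. -/
def leftMulSetoid (S : Set (D.Arc → Fin 2 → ℂ)) : Setoid S where
  r a b := ∃ B : SL(2, ℂ), D.leftMul B a.1 = b.1
  iseqv :=
    { refl := fun a => ⟨1, by funext i; simp [leftMul]⟩
      symm := fun {a b} ⟨B, h⟩ => ⟨B⁻¹, by
        rw [← h]; funext i
        simp only [leftMul, Matrix.mulVec_mulVec]
        rw [← Matrix.SpecialLinearGroup.coe_mul, inv_mul_cancel]
        simp⟩
      trans := fun {a b c} ⟨B, h⟩ ⟨B', h'⟩ => ⟨B' * B, by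
        rw [← h', ← h]; funext i
        simp only [leftMul, Matrix.mulVec_mulVec, Matrix.SpecialLinearGroup.coe_mul]⟩ }

end SignedGaussCode

/-!
A non-trivial matrix of trace `2` in `SL(2, ℂ)` is `M(v)` for a vector `v ≠ 0` that is unique up to
sign (`exists_quandleMap_eq`, `quandleMap_eq_iff`), and `M(B v) = B M(v) B⁻¹`. To color the arcs for
a given parabolic representation `ρ` is thus to choose, for every arc, one of the two vectors of its
meridian, and a sign-type prescribes how the choices are related along the knot.

The Wirtinger relations make this a parallel transport (`quandleRel_iff_transport`): the vector on
the edge after a passage is `ε_c ρ(f)⁻¹` applied to the vector on the edge before it, where `f` is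
the contribution of the passage to the blackboard-framed longitude, and no sign occurs at an
over-passage. A choice of `v` on the edge `0` therefore spreads to an arc-coloring of sign-type `ε`
if and only if it returns to itself after a full turn, where it has become
`[ε] ρ(ℓ)⁻¹ v` (`transport_two_mul`, `exists_coloring`).

The longitude commutes with the meridian of the edge `0` (`blackboardLongitude_commute`), hence
`M(ρ(ℓ) v) = M(v)` and `ρ(ℓ) v = λ v` with `λ = ±1`. As `det ρ(ℓ) = 1`, the trace of `ρ(ℓ)` is `2 λ`.
A change of framing multiplies by a power of `M(v)`, which fixes `v`, so every longitude has trace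
`2 λ` and `λ` is the obstruction class. The condition for a coloring to exist is `[ε] λ = 1`, that is
`[ε] = λ`. The only freedom is the sign of `v`, which changes the sign of the whole coloring.

For the bijections, equivariance shows that the action of `SL(2, ℂ)` conjugates the associated
representation, and `-1` exchanges the two colorings of a representation. It remains to see that
parabolic representations with the same character are conjugate (`exists_conj_of_trace_eq`). Two
Wirtinger generators have non-commuting images `M(u)`, `M(v)`, which means that `u`, `v` form a
basis. Since `tr M(u) M(v) = 2 - det(u, v)²`, the corresponding vectors for the other representation
have the same determinant after a choice of sign, and an element of `SL(2, ℂ)` carries one basis to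
the other. Once the two generators have the same images, the traces against `1`, `M(u)`, `M(v)` and
the products of the latter two determine all other images (`eq_of_trace_mul_eq`).
-/

/-! ### Parabolic elements of `SL(2, ℂ)` and their vectors -/

theorem quandleMap_val (v : Fin 2 → ℂ) :
    (quandleMap v).1 = !![1 - v 0 * v 1, v 0 ^ 2; -(v 1) ^ 2, 1 + v 0 * v 1] := rfl

/-- `M(u)` is the transvection along `u` for the determinant form. -/
theorem quandleMap_mulVec_apply (u v : Fin 2 → ℂ) :
    (quandleMap u).1.mulVec v = v + (u 0 * v 1 - u 1 * v 0) • u := by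
  ext i
  fin_cases i <;> simp [quandleMap, Matrix.mulVec, dotProduct, Fin.sum_univ_two] <;> ring

theorem quandleMap_mulVec_self (v : Fin 2 → ℂ) : (quandleMap v).1.mulVec v = v := by
  rw [quandleMap_mulVec_apply, mul_comm (v 1), sub_self, zero_smul, add_zero]

theorem quandleMap_zero : quandleMap 0 = 1 := by
  ext i j
  fin_cases i <;> fin_cases j <;> simp [quandleMap]

theorem quandleMap_neg (v : Fin 2 → ℂ) : quandleMap (-v) = quandleMap v := by
  simpa using quandleMap_unit_smul (-1) v

theorem quandleMap_eq_iff {u v : Fin 2 → ℂ} :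
    quandleMap u = quandleMap v ↔ u = v ∨ u = -v := by
  constructor
  · intro h
    have h00 : u 0 * u 1 = v 0 * v 1 := by
      have := congrArg (fun A : SL(2, ℂ) => A.1 0 0) h
      simpa [quandleMap] using this
    have h01 : u 0 ^ 2 = v 0 ^ 2 := by
      have := congrArg (fun A : SL(2, ℂ) => A.1 0 1) h
      simpa only [quandleMap, Matrix.of_apply, Matrix.cons_val] using this
    have h10 : u 1 ^ 2 = v 1 ^ 2 := by
      have := congrArg (fun A : SL(2, ℂ) => A.1 1 0) h
      simpa only [quandleMap, Matrix.of_apply, Matrix.cons_val, neg_inj] using this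
    simp only [funext_iff, Fin.forall_fin_two, Pi.neg_apply]
    rcases sq_eq_sq_iff_eq_or_eq_neg.1 h01 with h0 | h0 <;>
      rcases sq_eq_sq_iff_eq_or_eq_neg.1 h10 with h1 | h1 <;> grind
  · rintro (rfl | rfl)
    · rfl
    · exact quandleMap_neg v

theorem exists_quandleMap_eq {A : SL(2, ℂ)} (hA : A.1.trace = 2) : ∃ v, quandleMap v = A := by
  have hd : A.1 0 0 * A.1 1 1 - A.1 0 1 * A.1 1 0 = 1 := by
    rw [← Matrix.det_fin_two]; exact A.2
  rw [Matrix.trace_fin_two] at hA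
  obtain ⟨x, hx⟩ := IsAlgClosed.exists_eq_mul_self (A.1 0 1)
  obtain ⟨y, hy⟩ := IsAlgClosed.exists_eq_mul_self (-A.1 1 0)
  -- `det A = 1` and `tr A = 2` give `(x y)² = (1 - A₀₀)²`, so `y` needs at most a change of sign
  obtain ⟨z, hz, hxz⟩ : ∃ z, -A.1 1 0 = z * z ∧ x * z = 1 - A.1 0 0 := by
    have h : (x * y) ^ 2 = (1 - A.1 0 0) ^ 2 := by grind
    rcases sq_eq_sq_iff_eq_or_eq_neg.1 h with h | h
    · exact ⟨y, hy, h⟩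
    · exact ⟨-y, by rw [hy]; ring, by rw [mul_neg, h, neg_neg]⟩
  refine ⟨![x, z], ?_⟩
  ext i j
  fin_cases i <;> fin_cases j <;> simp [quandleMap] <;> grind

theorem mulVec_injective (A : SL(2, ℂ)) : Function.Injective A.1.mulVec := by
  intro u v h
  have := congrArg (A⁻¹).1.mulVec h
  simpa only [Matrix.mulVec_mulVec, ← Matrix.SpecialLinearGroup.coe_mul, inv_mul_cancel,
    Matrix.SpecialLinearGroup.coe_one, Matrix.one_mulVec] using this

theorem mulVec_unit_smul (A : SL(2, ℂ)) (s : ℤˣ) (v : Fin 2 → ℂ) :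
    A.1.mulVec (s • v) = s • A.1.mulVec v :=
  Matrix.mulVec_smul _ _ _

/-- By equivariance `M(A v) = A M(v) A⁻¹ = M(v)`, so `A v` is `v` or `-v`. -/
theorem exists_sign_of_commute {A : SL(2, ℂ)} {v : Fin 2 → ℂ}
    (h : A * quandleMap v = quandleMap v * A) : ∃ s : ℤˣ, A.1.mulVec v = s • v := by
  have hM : quandleMap (A.1.mulVec v) = quandleMap v := by
    rw [quandleMap_mulVec, h, mul_inv_cancel_right]
  rcases quandleMap_eq_iff.1 hM with h | h
  · exact ⟨1, by simpa using h⟩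
  · exact ⟨-1, by simpa using h⟩

/-- The determinant forces the second eigenvalue to be `s⁻¹ = s`. -/
theorem trace_of_mulVec_eq_sign_smul {A : SL(2, ℂ)} {v : Fin 2 → ℂ} (hv : v ≠ 0) {s : ℤˣ}
    (h : A.1.mulVec v = s • v) : A.1.trace = 2 * ((s : ℤ) : ℂ) := by
  have hd : A.1 0 0 * A.1 1 1 - A.1 0 1 * A.1 1 0 = 1 := by
    rw [← Matrix.det_fin_two]; exact A.2
  have hv' : v 0 ≠ 0 ∨ v 1 ≠ 0 := by
    by_contra! h0
    exact hv (by ext i; fin_cases i <;> simp [h0])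
  have h0 := congrFun h 0
  have h1 := congrFun h 1
  rw [Matrix.trace_fin_two]
  rcases Int.units_eq_one_or s with rfl | rfl <;>
    simp [Matrix.mulVec, dotProduct, Fin.sum_univ_two] at h0 h1 ⊢ <;>
    rcases hv' with hv' | hv' <;> apply mul_left_cancel₀ hv' <;> grind

theorem intCast_units_injective {s t : ℤˣ} (h : ((s : ℤ) : ℂ) = ((t : ℤ) : ℂ)) : s = t :=
  Units.ext (Int.cast_injective h)

theorem trace_mul_mul_inv (A B : SL(2, ℂ)) : (A * B * A⁻¹).1.trace = B.1.trace := by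
  rw [Matrix.SpecialLinearGroup.coe_mul, Matrix.trace_mul_comm, ← Matrix.SpecialLinearGroup.coe_mul,
    inv_mul_cancel_left]

theorem zpow_mulVec_eq_self {A : SL(2, ℂ)} {v : Fin 2 → ℂ} (h : A.1.mulVec v = v) (k : ℤ) :
    (A ^ k).1.mulVec v = v := by
  have h' : (A⁻¹).1.mulVec v = v := mulVec_injective A <| by
    rw [Matrix.mulVec_mulVec, ← Matrix.SpecialLinearGroup.coe_mul, mul_inv_cancel, h]
    simp
  induction k with
  | zero => simp
  | succ n ih =>
    rw [zpow_add_one, Matrix.SpecialLinearGroup.coe_mul, ← Matrix.mulVec_mulVec, h, ih]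
  | pred n ih =>
    rw [zpow_sub_one, Matrix.SpecialLinearGroup.coe_mul, ← Matrix.mulVec_mulVec, h', ih]

/-! ### Non-commuting pairs of parabolics -/

/-- Parabolics with proportional fixed vectors commute. -/
theorem quandleMap_commute {u v : Fin 2 → ℂ} (h : u 0 * v 1 - u 1 * v 0 = 0) :
    quandleMap u * quandleMap v = quandleMap v * quandleMap u := by
  have hM := quandleMap_mulVec (quandleMap u) v
  rw [quandleMap_mulVec_apply, h, zero_smul, add_zero] at hM
  rw [eq_mul_inv_iff_mul_eq] at hM
  exact hM.symm

theorem trace_quandleMap_mul (u v : Fin 2 → ℂ) :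
    (quandleMap u * quandleMap v).1.trace = 2 - (u 0 * v 1 - u 1 * v 0) ^ 2 := by
  rw [Matrix.SpecialLinearGroup.coe_mul, quandleMap_val, quandleMap_val, Matrix.mul_fin_two,
    Matrix.trace_fin_two_of]
  ring

/-- Two bases of the same determinant are matched by an element of `SL(2, ℂ)`. -/
theorem exists_mulVec_eq {u v u' v' : Fin 2 → ℂ} (h : u 0 * v 1 - u 1 * v 0 ≠ 0)
    (h' : u' 0 * v' 1 - u' 1 * v' 0 = u 0 * v 1 - u 1 * v 0) :
    ∃ B : SL(2, ℂ), B.1.mulVec u = u' ∧ B.1.mulVec v = v' := by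
  set w := u 0 * v 1 - u 1 * v 0 with hw
  refine ⟨⟨!![(u' 0 * v 1 - v' 0 * u 1) / w, (v' 0 * u 0 - u' 0 * v 0) / w;
    (u' 1 * v 1 - v' 1 * u 1) / w, (v' 1 * u 0 - u' 1 * v 0) / w], ?_⟩, ?_, ?_⟩
  · rw [Matrix.det_fin_two_of]
    field_simp
    linear_combination w * h' - (u' 0 * v' 1 - u' 1 * v' 0) * hw
  all_goals
    ext i
    fin_cases i <;> simp [Matrix.mulVec, dotProduct, Fin.sum_univ_two] <;> field_simp <;>
      rw [hw] <;> ring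

/-- Two non-commuting parabolics `P`, `Q` detect a matrix by its traces against `1`, `P`, `Q`, `PQ`
and `QP`. -/
theorem eq_of_trace_mul_eq {u v : Fin 2 → ℂ} (h : u 0 * v 1 - u 1 * v 0 ≠ 0) {A B : SL(2, ℂ)}
    (h1 : A.1.trace = B.1.trace)
    (hu : (A * quandleMap u).1.trace = (B * quandleMap u).1.trace)
    (hv : (A * quandleMap v).1.trace = (B * quandleMap v).1.trace)
    (huv : (A * (quandleMap u * quandleMap v)).1.trace =
      (B * (quandleMap u * quandleMap v)).1.trace)
    (hvu : (A * (quandleMap v * quandleMap u)).1.trace =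
      (B * (quandleMap v * quandleMap u)).1.trace) : A = B := by
  simp only [Matrix.SpecialLinearGroup.coe_mul, Matrix.trace_fin_two, Matrix.mul_apply,
    Fin.sum_univ_two, quandleMap_val, Matrix.of_apply, Matrix.cons_val] at h1 hu hv huv hvu
  set w := u 0 * v 1 - u 1 * v 0 with hw
  set a := A.1 0 0 - B.1 0 0
  set b := A.1 0 1 - B.1 0 1
  set c := A.1 1 0 - B.1 1 0
  set d := A.1 1 1 - B.1 1 1
  -- the differences of traces give the values of the bilinear form `(p, q) ↦ det (p, (A - B) q)`
  -- on the basis `u`, `v`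
  have euu : u 0 * (c * u 0 + d * u 1) - u 1 * (a * u 0 + b * u 1) = 0 := by
    linear_combination hu - h1
  have evv : v 0 * (c * v 0 + d * v 1) - v 1 * (a * v 0 + b * v 1) = 0 := by
    linear_combination hv - h1
  have evu : v 0 * (c * u 0 + d * u 1) - v 1 * (a * u 0 + b * u 1) = 0 := by
    apply mul_left_cancel₀ h
    linear_combination huv - hu - hv + h1
  have euv : u 0 * (c * v 0 + d * v 1) - u 1 * (a * v 0 + b * v 1) = 0 := by
    apply mul_left_cancel₀ h
    linear_combination -(hvu - hu - hv + h1)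
  have hu0 : a * u 0 + b * u 1 = 0 := by
    apply mul_left_cancel₀ h
    linear_combination v 0 * euu - u 0 * evu
  have hu1 : c * u 0 + d * u 1 = 0 := by
    apply mul_left_cancel₀ h
    linear_combination v 1 * euu - u 1 * evu
  have hv0 : a * v 0 + b * v 1 = 0 := by
    apply mul_left_cancel₀ h
    linear_combination v 0 * euv - u 0 * evv
  have hv1 : c * v 0 + d * v 1 = 0 := by
    apply mul_left_cancel₀ h
    linear_combination v 1 * euv - u 1 * evv
  have ha0 : a = 0 := by
    apply mul_left_cancel₀ h
    linear_combination v 1 * hu0 - u 1 * hv0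
  have hb0 : b = 0 := by
    apply mul_left_cancel₀ h
    linear_combination u 0 * hv0 - v 0 * hu0
  have hc0 : c = 0 := by
    apply mul_left_cancel₀ h
    linear_combination v 1 * hu1 - u 1 * hv1
  have hd0 : d = 0 := by
    apply mul_left_cancel₀ h
    linear_combination u 0 * hv1 - v 0 * hu1
  ext i j
  fin_cases i <;> fin_cases j
  · exact sub_eq_zero.1 ha0
  · exact sub_eq_zero.1 hb0
  · exact sub_eq_zero.1 hc0
  · exact sub_eq_zero.1 hd0

namespace SignedGaussCode

variable {N : ℕ} (D : SignedGaussCode N)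

/-! ### Meridians and the longitude along the knot -/

theorem neZero_two_mul (D : SignedGaussCode N) : NeZero (2 * N) := by
  refine ⟨mul_ne_zero two_ne_zero ?_⟩
  rintro rfl
  exact (D.visit 0).1.elim0

theorem visit_underPassage (c : Fin N) : D.visit (D.underPassage c) = (c, false) :=
  D.visit.apply_symm_apply _

theorem arcOfEdge_eq_of_over {p : ZMod (2 * N)} (hp : (D.visit p).2 = true) :
    D.arcOfEdge p = D.arcOfEdge (p - 1) :=
  (Quot.sound ⟨(sub_add_cancel p 1).symm, hp⟩).symm

theorem eq_underPassage_of_under {p : ZMod (2 * N)} (hp : (D.visit p).2 = false) :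
    p = D.underPassage (D.visit p).1 := by
  rw [underPassage, Equiv.eq_symm_apply]
  exact Prod.ext rfl hp

/-- The Wirtinger relation at a passage: the longitude factor conjugates the meridian of the edge
after the passage to that of the edge before it. -/
theorem wirtinger_arcOfEdge (p : ZMod (2 * N)) :
    D.wirtinger (D.arcOfEdge p) =
      (D.longitudeFactor p)⁻¹ * D.wirtinger (D.arcOfEdge (p - 1)) * D.longitudeFactor p := by
  rcases hp : (D.visit p).2 with _ | _
  · have hrel : (PresentedGroup.mk (Set.range D.relator)) (D.relator (D.visit p).1) = 1 :=
      PresentedGroup.one_of_mem ⟨_, rfl⟩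
    have hin : D.arcIn (D.visit p).1 = D.arcOfEdge (p - 1) := by
      rw [arcIn, ← D.eq_underPassage_of_under hp]
    have hout : D.arcOut (D.visit p).1 = D.arcOfEdge p := by
      rw [arcOut, ← D.eq_underPassage_of_under hp]
    rw [relator, hin, hout] at hrel
    simp only [longitudeFactor, hp, Bool.false_eq_true, if_false]
    rcases Int.units_eq_one_or (D.sign (D.visit p).1) with hs | hs
    · simp only [hs, if_true, map_mul, map_inv] at hrel
      simp only [hs, Units.val_one, zpow_one]
      rw [mul_assoc, mul_assoc, inv_mul_eq_one, ← mul_assoc] at hrel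
      exact hrel
    · have h1 : (-1 : ℤˣ) ≠ 1 := by decide
      simp only [hs, h1, if_false, map_mul, map_inv] at hrel
      simp only [hs, Units.val_neg, Units.val_one, zpow_neg, zpow_one, inv_inv]
      rw [mul_assoc, mul_assoc, inv_mul_eq_one, ← mul_assoc] at hrel
      exact hrel
  · simp [longitudeFactor, hp, D.arcOfEdge_eq_of_over hp]

/-- The part of the blackboard longitude that runs through the passages `1, …, n`. -/
def partialLongitude (n : ℕ) : D.KnotGroup :=
  ((List.range n).map fun r => D.longitudeFactor ((r + 1 : ℕ) : ZMod (2 * N))).prod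

theorem partialLongitude_zero : D.partialLongitude 0 = 1 := by simp [partialLongitude]

theorem partialLongitude_succ (n : ℕ) : D.partialLongitude (n + 1) =
    D.partialLongitude n * D.longitudeFactor ((n + 1 : ℕ) : ZMod (2 * N)) := by
  simp [partialLongitude, List.range_succ]

theorem wirtinger_eq_partialLongitude_conj (n : ℕ) :
    D.wirtinger (D.arcOfEdge (n : ZMod (2 * N))) =
      (D.partialLongitude n)⁻¹ * D.wirtinger (D.arcOfEdge 0) * D.partialLongitude n := by
  induction n with
  | zero => simp [partialLongitude_zero]
  | succ n ih =>
    rw [wirtinger_arcOfEdge, Nat.cast_succ, add_sub_cancel_right, ih, partialLongitude_succ,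
      Nat.cast_succ]
    group

/-- The passage `2 N` is the passage `0`, so conjugation by the whole longitude returns the meridian
of the edge `0` to itself. -/
theorem blackboardLongitude_commute :
    D.blackboardLongitude * D.wirtinger (D.arcOfEdge 0) =
      D.wirtinger (D.arcOfEdge 0) * D.blackboardLongitude := by
  have h := D.wirtinger_eq_partialLongitude_conj (2 * N)
  rw [ZMod.natCast_self, mul_assoc, eq_inv_mul_iff_mul_eq] at h
  exact h

/-! ### Quandle relations as parallel transport -/

/-- The sign attached to a passage by a sign-type: that of the crossing at an under-passage, and `1`
at an over-passage. -/
def passageSign (ε : Fin N → ℤˣ) (p : ZMod (2 * N)) : ℤˣ :=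
  if (D.visit p).2 = true then 1 else ε (D.visit p).1

theorem prod_passageSign (ε : Fin N → ℤˣ) :
    ∏ r ∈ Finset.range (2 * N), D.passageSign ε ((r + 1 : ℕ) : ZMod (2 * N)) = totalSign ε := by
  have := D.neZero_two_mul
  have hcyc : ∏ r ∈ Finset.range (2 * N), D.passageSign ε ((r + 1 : ℕ) : ZMod (2 * N)) =
      ∏ p : ZMod (2 * N), D.passageSign ε p := by
    -- the passages are met in the order `1, …, 2 N`, so the shift by one is undone in `ZMod (2 * N)`
    refine Finset.prod_bij' (fun r _ => ((r + 1 : ℕ) : ZMod (2 * N)))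
      (fun p _ => (p - 1).val) ?_ ?_ ?_ ?_ ?_
    · simp
    · intro p _
      exact Finset.mem_range.2 (ZMod.val_lt _)
    · intro r hr
      simp [ZMod.val_natCast_of_lt (Finset.mem_range.1 hr)]
    · intro p _
      simp
    · simp
  rw [hcyc, ← D.visit.symm.prod_comp, Fintype.prod_prod_type]
  simp [passageSign, totalSign]

/-- Quandle relations as parallel transport: at every passage the vector of the edge after it is,
up to the sign of the passage, the image of the vector of the edge before it under the inverse of
the longitude factor. -/
theorem quandleRel_iff_transport {ρ : D.KnotGroup →* SL(2, ℂ)} {a : D.Arc → Fin 2 → ℂ}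
    (ha : ∀ i, quandleMap (a i) = ρ (D.wirtinger i)) (ε : Fin N → ℤˣ) :
    (∀ c, D.QuandleRel a c (ε c)) ↔ ∀ p, D.passageSign ε p • a (D.arcOfEdge p) =
      ((ρ (D.longitudeFactor p))⁻¹ : SL(2, ℂ)).1.mulVec (a (D.arcOfEdge (p - 1))) := by
  have key : ∀ c, D.QuandleRel a c (ε c) ↔
      ε c • a (D.arcOfEdge (D.underPassage c)) =
        ((ρ (D.longitudeFactor (D.underPassage c)))⁻¹ : SL(2, ℂ)).1.mulVec
          (a (D.arcOfEdge (D.underPassage c - 1))) := by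
    intro c
    simp only [QuandleRel, longitudeFactor, visit_underPassage, Bool.false_eq_true, if_false,
      arcOut, arcIn, quandleRight, quandleLeft, ha]
    rcases Int.units_eq_one_or (D.sign c) with hs | hs
    · simp [hs]
    · have h1 : (-1 : ℤˣ) ≠ 1 := by decide
      simp only [hs, h1, if_false, Units.val_neg, Units.val_one, zpow_neg, zpow_one, map_inv,
        inv_inv]
  constructor
  · intro h p
    rcases hp : (D.visit p).2 with _ | _
    · have := (key _).1 (h (D.visit p).1)
      rw [← D.eq_underPassage_of_under hp] at this
      simpa [passageSign, hp] using this
    · simp [passageSign, longitudeFactor, hp, D.arcOfEdge_eq_of_over hp]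
  · intro h c
    rw [key]
    simpa [passageSign, visit_underPassage] using h (D.underPassage c)

/-- The vector obtained from `v` on the edge `0` by transport through the passages `1, …, n`. -/
def transport (ρ : D.KnotGroup →* SL(2, ℂ)) (ε : Fin N → ℤˣ) (v : Fin 2 → ℂ) (n : ℕ) :
    Fin 2 → ℂ :=
  (∏ r ∈ Finset.range n, D.passageSign ε ((r + 1 : ℕ) : ZMod (2 * N))) •
    ((ρ (D.partialLongitude n))⁻¹ : SL(2, ℂ)).1.mulVec v

theorem transport_zero (ρ : D.KnotGroup →* SL(2, ℂ)) (ε : Fin N → ℤˣ) (v : Fin 2 → ℂ) :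
    D.transport ρ ε v 0 = v := by
  simp [transport, partialLongitude_zero]

theorem transport_succ (ρ : D.KnotGroup →* SL(2, ℂ)) (ε : Fin N → ℤˣ) (v : Fin 2 → ℂ) (n : ℕ) :
    D.transport ρ ε v (n + 1) = D.passageSign ε ((n + 1 : ℕ) : ZMod (2 * N)) •
      ((ρ (D.longitudeFactor ((n + 1 : ℕ) : ZMod (2 * N))))⁻¹ : SL(2, ℂ)).1.mulVec
        (D.transport ρ ε v n) := by
  rw [transport, transport, partialLongitude_succ, map_mul, mul_inv_rev,
    Matrix.SpecialLinearGroup.coe_mul, ← Matrix.mulVec_mulVec, mulVec_unit_smul, smul_smul,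
    Finset.prod_range_succ, mul_comm]

theorem quandleMap_transport {ρ : D.KnotGroup →* SL(2, ℂ)} (ε : Fin N → ℤˣ) {v : Fin 2 → ℂ}
    (hv : quandleMap v = ρ (D.wirtinger (D.arcOfEdge 0))) (n : ℕ) :
    quandleMap (D.transport ρ ε v n) = ρ (D.wirtinger (D.arcOfEdge (n : ZMod (2 * N)))) := by
  rw [transport, quandleMap_unit_smul, quandleMap_mulVec, hv, wirtinger_eq_partialLongitude_conj]
  simp

/-- After a full turn the transport has multiplied an eigenvector of the longitude by the total sign
times the eigenvalue. -/
theorem transport_two_mul {ρ : D.KnotGroup →* SL(2, ℂ)} (ε : Fin N → ℤˣ) {v : Fin 2 → ℂ}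
    {s : ℤˣ} (h : (ρ D.blackboardLongitude).1.mulVec v = s • v) :
    D.transport ρ ε v (2 * N) = (totalSign ε * s) • v := by
  rw [transport, prod_passageSign, mul_smul]
  congr 1
  change ((ρ D.blackboardLongitude)⁻¹ : SL(2, ℂ)).1.mulVec v = s • v
  apply mulVec_injective (ρ D.blackboardLongitude)
  rw [mulVec_unit_smul, h, smul_smul, Int.units_mul_self, one_smul, Matrix.mulVec_mulVec,
    ← Matrix.SpecialLinearGroup.coe_mul, mul_inv_cancel]
  simp

theorem eq_transport_of_quandleRel {ρ : D.KnotGroup →* SL(2, ℂ)} {a : D.Arc → Fin 2 → ℂ}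
    (ha : ∀ i, quandleMap (a i) = ρ (D.wirtinger i)) {ε : Fin N → ℤˣ}
    (h : ∀ c, D.QuandleRel a c (ε c)) (n : ℕ) :
    a (D.arcOfEdge (n : ZMod (2 * N))) = D.transport ρ ε (a (D.arcOfEdge 0)) n := by
  rw [quandleRel_iff_transport D ha] at h
  induction n with
  | zero => simp [transport_zero]
  | succ n ih =>
    rw [transport_succ, ← ih]
    have := h ((n + 1 : ℕ) : ZMod (2 * N))
    rw [Nat.cast_succ, add_sub_cancel_right] at this
    rw [Nat.cast_succ, ← this, smul_smul, Int.units_mul_self, one_smul]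

/-! ### Arc-colorings from transport -/

theorem eq_of_apply_arcOfEdge {α : Sort*} {a b : D.Arc → α}
    (h : ∀ n : ℕ, a (D.arcOfEdge (n : ZMod (2 * N))) = b (D.arcOfEdge (n : ZMod (2 * N)))) :
    a = b := by
  have := D.neZero_two_mul
  funext i
  obtain ⟨p, rfl⟩ := Quot.exists_rep i
  have hp := h p.val
  rwa [ZMod.natCast_rightInverse] at hp

/-- A vector that returns to itself after a full turn of transport spreads to an arc-coloring. -/
theorem exists_coloring {ρ : D.KnotGroup →* SL(2, ℂ)} {ε : Fin N → ℤˣ} {v : Fin 2 → ℂ}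
    (hv : quandleMap v = ρ (D.wirtinger (D.arcOfEdge 0)))
    (hper : D.transport ρ ε v (2 * N) = v) :
    ∃ a : D.Arc → Fin 2 → ℂ, (∀ i, quandleMap (a i) = ρ (D.wirtinger i)) ∧
      (∀ c, D.QuandleRel a c (ε c)) ∧ a (D.arcOfEdge 0) = v := by
  have := D.neZero_two_mul
  -- the case `n = 2 N` is the periodicity
  have hval : ∀ n ≤ 2 * N, D.transport ρ ε v (n : ZMod (2 * N)).val = D.transport ρ ε v n := by
    intro n hn
    rcases hn.lt_or_eq with h | rfl
    · rw [ZMod.val_natCast_of_lt h]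
    · rw [ZMod.natCast_self, ZMod.val_zero, transport_zero, hper]
  have hstep : ∀ p : ZMod (2 * N), D.transport ρ ε v (p + 1).val = D.passageSign ε (p + 1) •
      ((ρ (D.longitudeFactor (p + 1)))⁻¹ : SL(2, ℂ)).1.mulVec (D.transport ρ ε v p.val) := by
    intro p
    have h := hval (p.val + 1) p.val_lt
    rw [transport_succ] at h
    simpa using h
  let a : D.Arc → Fin 2 → ℂ := Quot.lift (fun p => D.transport ρ ε v p.val) <| by
    rintro p _ ⟨rfl, hp⟩
    rw [hstep]
    simp [passageSign, longitudeFactor, hp]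
  have ha : ∀ i, quandleMap (a i) = ρ (D.wirtinger i) := by
    intro i
    obtain ⟨p, rfl⟩ := Quot.exists_rep i
    have h := D.quandleMap_transport ε hv p.val
    rw [ZMod.natCast_rightInverse] at h
    exact h
  refine ⟨a, ha, (D.quandleRel_iff_transport ha ε).2 fun p => ?_, ?_⟩
  · change D.passageSign ε p • D.transport ρ ε v p.val =
      ((ρ (D.longitudeFactor p))⁻¹ : SL(2, ℂ)).1.mulVec (D.transport ρ ε v (p - 1).val)
    have h := hstep (p - 1)
    rw [sub_add_cancel] at h
    rw [h, smul_smul, Int.units_mul_self, one_smul]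
  · change D.transport ρ ε v (0 : ZMod (2 * N)).val = v
    rw [ZMod.val_zero, transport_zero]

/-! ### Parabolic representations and the obstruction class -/

theorem isMeridian_wirtinger (i : D.Arc) : D.IsMeridian (D.wirtinger i) :=
  ⟨i, Or.inl (IsConj.refl _)⟩

theorem trace_eq_of_isConj {ρ : D.KnotGroup →* SL(2, ℂ)} {g h : D.KnotGroup} (hgh : IsConj g h) :
    (ρ g).1.trace = (ρ h).1.trace := by
  obtain ⟨c, rfl⟩ := isConj_iff.1 hgh
  rw [map_mul, map_mul, map_inv, trace_mul_mul_inv]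

theorem assocRep_eq_iff {a : D.Arc → Fin 2 → ℂ} (ha : a ∈ D.quandleSystemStar)
    {ρ : D.KnotGroup →* SL(2, ℂ)} :
    D.assocRep a ha = ρ ↔ ∀ i, quandleMap (a i) = ρ (D.wirtinger i) := by
  have h : ∀ i, D.assocRep a ha (D.wirtinger i) = quandleMap (a i) := fun i =>
    PresentedGroup.toGroup.of (D.lift_relator_eq_one ha)
  constructor
  · rintro rfl i
    exact (h i).symm
  · intro hρ
    exact PresentedGroup.ext fun i => (h i).trans (hρ i)

theorem quandleMap_eq_assocRep {a : D.Arc → Fin 2 → ℂ} (ha : a ∈ D.quandleSystemStar) (i : D.Arc) :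
    quandleMap (a i) = D.assocRep a ha (D.wirtinger i) :=
  (D.assocRep_eq_iff ha).1 rfl i

theorem exists_mem_signedQuandleSystem_iff {ρ : D.KnotGroup →* SL(2, ℂ)} (hρ : D.IsParabolic ρ)
    {ε : Fin N → ℤˣ} {a : D.Arc → Fin 2 → ℂ} :
    (∃ h : a ∈ D.signedQuandleSystem ε, D.assocRep a h.1.1 = ρ) ↔
      (∀ i, quandleMap (a i) = ρ (D.wirtinger i)) ∧ ∀ c, D.QuandleRel a c (ε c) := by
  constructor
  · rintro ⟨h, rfl⟩
    exact ⟨D.quandleMap_eq_assocRep _, h.2⟩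
  · rintro ⟨ha, hrel⟩
    have hstar : a ∈ D.quandleSystemStar := fun c => ⟨ε c, hrel c⟩
    have h := (D.assocRep_eq_iff hstar).2 ha
    exact ⟨⟨⟨hstar, h ▸ hρ⟩, hrel⟩, h⟩

variable {D} in
theorem IsParabolic.ne_zero {ρ : D.KnotGroup →* SL(2, ℂ)} (hρ : D.IsParabolic ρ) {i : D.Arc}
    {v : Fin 2 → ℂ} (hv : quandleMap v = ρ (D.wirtinger i)) : v ≠ 0 := by
  rintro rfl
  rw [quandleMap_zero] at hv
  exact (hρ.2 _ (D.isMeridian_wirtinger i)).2 hv.symm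

variable {D} in
theorem IsParabolic.exists_quandleMap_eq {ρ : D.KnotGroup →* SL(2, ℂ)} (hρ : D.IsParabolic ρ)
    (i : D.Arc) : ∃ v, quandleMap v = ρ (D.wirtinger i) :=
  _root_.exists_quandleMap_eq (hρ.2 _ (D.isMeridian_wirtinger i)).1

/-- The longitude commutes with the meridian of the edge `0`, so the vector of that meridian is an
eigenvector of it. -/
theorem exists_longitude_sign {ρ : D.KnotGroup →* SL(2, ℂ)} {v : Fin 2 → ℂ}
    (hv : quandleMap v = ρ (D.wirtinger (D.arcOfEdge 0))) :
    ∃ s : ℤˣ, (ρ D.blackboardLongitude).1.mulVec v = s • v := by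
  apply exists_sign_of_commute
  rw [hv, ← map_mul, blackboardLongitude_commute, map_mul]

/-- All longitudes have the eigenvalue of the blackboard-framed one, because they differ from it by
powers of a meridian, which fix its eigenvector. -/
theorem trace_of_isLongitude {ρ : D.KnotGroup →* SL(2, ℂ)} {v : Fin 2 → ℂ} (hv0 : v ≠ 0)
    (hv : quandleMap v = ρ (D.wirtinger (D.arcOfEdge 0))) {s : ℤˣ}
    (hs : (ρ D.blackboardLongitude).1.mulVec v = s • v) {l : D.KnotGroup} (hl : D.IsLongitude l) :
    (ρ l).1.trace = 2 * ((s : ℤ) : ℂ) := by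
  obtain ⟨k, hk⟩ := hl
  rw [← D.trace_eq_of_isConj hk]
  apply trace_of_mulVec_eq_sign_smul hv0
  rw [map_mul, map_zpow, ← hv, Matrix.SpecialLinearGroup.coe_mul, ← Matrix.mulVec_mulVec,
    zpow_mulVec_eq_self (quandleMap_mulVec_self v), hs]

theorem isLongitude_preferredLongitude : D.IsLongitude D.preferredLongitude :=
  ⟨-D.writhe, IsConj.refl _⟩

theorem obstructionClass_eq {ρ : D.KnotGroup →* SL(2, ℂ)} {v : Fin 2 → ℂ} (hv0 : v ≠ 0)
    (hv : quandleMap v = ρ (D.wirtinger (D.arcOfEdge 0))) {s : ℤˣ}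
    (hs : (ρ D.blackboardLongitude).1.mulVec v = s • v) :
    D.obstructionClass ρ = ((s : ℤ) : ℂ) := by
  rw [obstructionClass, D.trace_of_isLongitude hv0 hv hs D.isLongitude_preferredLongitude]
  ring

variable {D} in
theorem IsParabolic.obstructionClass_sign {ρ : D.KnotGroup →* SL(2, ℂ)} (hρ : D.IsParabolic ρ) :
    ∃ s : ℤˣ, D.obstructionClass ρ = ((s : ℤ) : ℂ) ∧
      ∀ l, D.IsLongitude l → (ρ l).1.trace = 2 * D.obstructionClass ρ := by
  obtain ⟨v, hv⟩ := hρ.exists_quandleMap_eq (D.arcOfEdge 0)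
  obtain ⟨s, hs⟩ := D.exists_longitude_sign hv
  have hob := D.obstructionClass_eq (hρ.ne_zero hv) hv hs
  exact ⟨s, hob, fun l hl => by rw [hob, D.trace_of_isLongitude (hρ.ne_zero hv) hv hs hl]⟩

/-- An arc-coloring returns to its value after a full turn of transport, so the eigenvalue of the
longitude is the total sign. -/
theorem obstructionClass_assocRep {ε : Fin N → ℤˣ} {a : D.Arc → Fin 2 → ℂ}
    (ha : a ∈ D.signedQuandleSystem ε) :
    D.obstructionClass (D.assocRep a ha.1.1) = ((totalSign ε : ℤ) : ℂ) := by
  have hM := D.quandleMap_eq_assocRep ha.1.1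
  have hρ : D.IsParabolic (D.assocRep a ha.1.1) := ha.1.2
  have hv0 := hρ.ne_zero (hM (D.arcOfEdge 0))
  obtain ⟨s, hs⟩ := D.exists_longitude_sign (hM (D.arcOfEdge 0))
  rw [D.obstructionClass_eq hv0 (hM _) hs]
  have h := D.eq_transport_of_quandleRel hM ha.2 (2 * N)
  rw [D.transport_two_mul ε hs, ZMod.natCast_self] at h
  rcases Int.units_eq_one_or (totalSign ε) with ht | ht <;>
    rcases Int.units_eq_one_or s with rfl | rfl <;> rw [ht] at h ⊢
  · exact absurd (self_eq_neg.1 (by simpa using h)) hv0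
  · exact absurd (self_eq_neg.1 (by simpa using h)) hv0

theorem exists_coloring_of_obstructionClass {ρ : D.KnotGroup →* SL(2, ℂ)} (hρ : D.IsParabolic ρ)
    {ε : Fin N → ℤˣ} (h : D.obstructionClass ρ = ((totalSign ε : ℤ) : ℂ)) :
    ∃ a, ∃ ha : a ∈ D.signedQuandleSystem ε, D.assocRep a ha.1.1 = ρ := by
  obtain ⟨v, hv⟩ := hρ.exists_quandleMap_eq (D.arcOfEdge 0)
  obtain ⟨s, hs⟩ := D.exists_longitude_sign hv
  have hob := D.obstructionClass_eq (hρ.ne_zero hv) hv hs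
  obtain rfl : totalSign ε = s := intCast_units_injective (h.symm.trans hob)
  have hper := D.transport_two_mul ε hs
  rw [Int.units_mul_self, one_smul] at hper
  obtain ⟨a, ha, hrel, -⟩ := D.exists_coloring hv hper
  exact ⟨a, (D.exists_mem_signedQuandleSystem_iff hρ).2 ⟨ha, hrel⟩⟩

/-! ### Uniqueness of arc-colorings and the action of `SL(2, ℂ)` -/

/-- A coloring is determined by the representation, the sign-type and its vector on the edge `0`,
and the meridian determines that vector up to sign. -/
theorem eq_or_eq_neg_of_quandleRel {ρ : D.KnotGroup →* SL(2, ℂ)} {ε : Fin N → ℤˣ}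
    {a b : D.Arc → Fin 2 → ℂ}
    (ha : ∀ i, quandleMap (a i) = ρ (D.wirtinger i)) (ha' : ∀ c, D.QuandleRel a c (ε c))
    (hb : ∀ i, quandleMap (b i) = ρ (D.wirtinger i)) (hb' : ∀ c, D.QuandleRel b c (ε c)) :
    b = a ∨ b = -a := by
  rcases quandleMap_eq_iff.1 ((hb (D.arcOfEdge 0)).trans (ha (D.arcOfEdge 0)).symm) with h | h
  · refine Or.inl (D.eq_of_apply_arcOfEdge fun n => ?_)
    rw [D.eq_transport_of_quandleRel ha ha', D.eq_transport_of_quandleRel hb hb', h]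
  · refine Or.inr (D.eq_of_apply_arcOfEdge fun n => ?_)
    rw [Pi.neg_apply, D.eq_transport_of_quandleRel ha ha', D.eq_transport_of_quandleRel hb hb', h,
      transport, transport, Matrix.mulVec_neg, smul_neg]

theorem quandleRel_leftMul {a : D.Arc → Fin 2 → ℂ} {c : Fin N} {s : ℤˣ} (B : SL(2, ℂ))
    (h : D.QuandleRel a c s) : D.QuandleRel (D.leftMul B a) c s := by
  have hB := congrArg B.1.mulVec h
  rw [mulVec_unit_smul] at hB
  rw [QuandleRel]
  refine hB.trans ?_
  split_ifs
  · simp only [leftMul, quandleRight, quandleMap_mulVec, Matrix.mulVec_mulVec, mul_inv_rev, inv_inv,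
      ← Matrix.SpecialLinearGroup.coe_mul, mul_assoc, inv_mul_cancel, mul_one]
  · simp only [leftMul, quandleLeft, quandleMap_mulVec, Matrix.mulVec_mulVec,
      ← Matrix.SpecialLinearGroup.coe_mul, inv_mul_cancel_right]

theorem leftMul_neg_one (a : D.Arc → Fin 2 → ℂ) : D.leftMul (-1) a = -a := by
  funext i
  simp [leftMul, Matrix.neg_mulVec]

theorem leftMul_mul (A B : SL(2, ℂ)) (a : D.Arc → Fin 2 → ℂ) :
    D.leftMul (A * B) a = D.leftMul A (D.leftMul B a) := by
  funext i
  rw [leftMul, leftMul, leftMul, Matrix.mulVec_mulVec, Matrix.SpecialLinearGroup.coe_mul]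

variable {D} in
theorem IsParabolic.conj {ρ : D.KnotGroup →* SL(2, ℂ)} (hρ : D.IsParabolic ρ) (B : SL(2, ℂ)) :
    D.IsParabolic ((MulAut.conj B).toMonoidHom.comp ρ) := by
  obtain ⟨⟨g, h, hgh⟩, hm⟩ := hρ
  refine ⟨⟨g, h, fun e => hgh ?_⟩, fun m hmer => ⟨?_, fun e => (hm m hmer).2 ?_⟩⟩
  · simpa [← map_mul] using e
  · exact (trace_mul_mul_inv B (ρ m)).trans (hm m hmer).1
  · simpa using e

theorem exists_leftMul_mem {ε : Fin N → ℤˣ} {a : D.Arc → Fin 2 → ℂ}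
    (ha : a ∈ D.signedQuandleSystem ε) (B : SL(2, ℂ)) :
    ∃ h : D.leftMul B a ∈ D.signedQuandleSystem ε,
      D.assocRep _ h.1.1 = (MulAut.conj B).toMonoidHom.comp (D.assocRep a ha.1.1) := by
  have hρ : D.IsParabolic (D.assocRep a ha.1.1) := ha.1.2
  refine (D.exists_mem_signedQuandleSystem_iff (hρ.conj B)).2
    ⟨fun i => ?_, fun c => D.quandleRel_leftMul B (ha.2 c)⟩
  rw [leftMul, quandleMap_mulVec, D.quandleMap_eq_assocRep ha.1.1]
  rfl

theorem coloring_iff {ρ : D.KnotGroup →* SL(2, ℂ)} (hρ : D.IsParabolic ρ) {ε : Fin N → ℤˣ}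
    {a : D.Arc → Fin 2 → ℂ} (ha : a ∈ D.signedQuandleSystem ε) (haρ : D.assocRep a ha.1.1 = ρ)
    (b : D.Arc → Fin 2 → ℂ) :
    (∃ hb : b ∈ D.signedQuandleSystem ε, D.assocRep b hb.1.1 = ρ) ↔ (b = a ∨ b = -a) := by
  have ha' := (D.exists_mem_signedQuandleSystem_iff hρ).1 ⟨ha, haρ⟩
  constructor
  · intro hb
    have hb' := (D.exists_mem_signedQuandleSystem_iff hρ).1 hb
    exact D.eq_or_eq_neg_of_quandleRel ha'.1 ha'.2 hb'.1 hb'.2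
  · rintro (rfl | rfl)
    · exact ⟨ha, haρ⟩
    · rw [D.exists_mem_signedQuandleSystem_iff hρ, ← leftMul_neg_one]
      refine ⟨fun i => ?_, fun c => D.quandleRel_leftMul _ (ha'.2 c)⟩
      rw [leftMul_neg_one, Pi.neg_apply, quandleMap_neg, ha'.1]

/-! ### Characters and conjugacy classes -/

variable {D} in
/-- The Wirtinger generators generate the knot group, so a non-abelian representation separates two
of them. -/
theorem IsParabolic.exists_wirtinger_not_commute {ρ : D.KnotGroup →* SL(2, ℂ)}
    (hρ : D.IsParabolic ρ) : ∃ i j, ρ (D.wirtinger i) * ρ (D.wirtinger j) ≠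
      ρ (D.wirtinger j) * ρ (D.wirtinger i) := by
  by_contra! hcomm
  obtain ⟨⟨g, h, hgh⟩, -⟩ := hρ
  -- a matrix that commutes with the images of the generators commutes with the whole image
  have key : ∀ A : SL(2, ℂ), (∀ i, A * ρ (D.wirtinger i) = ρ (D.wirtinger i) * A) →
      ∀ x, A * ρ x = ρ x * A := by
    intro A hA x
    have heq : (MulAut.conj A).toMonoidHom.comp ρ = ρ := PresentedGroup.ext fun i => by
      change A * ρ (D.wirtinger i) * A⁻¹ = ρ (D.wirtinger i)
      rw [hA, mul_inv_cancel_right]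
    have hx := DFunLike.congr_fun heq x
    exact mul_inv_eq_iff_eq_mul.1 hx
  exact hgh (key (ρ g) (fun i => (key _ (hcomm i) g).symm) h)

/-- Parabolic representations with the same character are conjugate: two Wirtinger generators
with non-commuting images can be matched by a conjugation, and then the traces determine the rest. -/
theorem exists_conj_of_trace_eq {ρ ρ' : D.KnotGroup →* SL(2, ℂ)} (hρ : D.IsParabolic ρ)
    (hρ' : D.IsParabolic ρ') (h : ∀ g, (ρ g).1.trace = (ρ' g).1.trace) :
    ∃ A : SL(2, ℂ), ∀ g, ρ' g = A * ρ g * A⁻¹ := by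
  obtain ⟨i, j, hij⟩ := hρ.exists_wirtinger_not_commute
  obtain ⟨u, hu⟩ := hρ.exists_quandleMap_eq i
  obtain ⟨v, hv⟩ := hρ.exists_quandleMap_eq j
  obtain ⟨u', hu'⟩ := hρ'.exists_quandleMap_eq i
  obtain ⟨v', hv'⟩ := hρ'.exists_quandleMap_eq j
  have hdet : u 0 * v 1 - u 1 * v 0 ≠ 0 := fun h0 => hij (by rw [← hu, ← hv, quandleMap_commute h0])
  have hsq : (u' 0 * v' 1 - u' 1 * v' 0) ^ 2 = (u 0 * v 1 - u 1 * v 0) ^ 2 := by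
    have htr := h (D.wirtinger i * D.wirtinger j)
    rw [map_mul, map_mul, ← hu, ← hv, ← hu', ← hv', trace_quandleMap_mul,
      trace_quandleMap_mul] at htr
    exact (sub_right_injective htr).symm
  -- `v'` is determined up to sign, and the sign is chosen to match the determinants
  obtain ⟨w, hw, hdet'⟩ : ∃ w, quandleMap w = ρ' (D.wirtinger j) ∧
      u' 0 * w 1 - u' 1 * w 0 = u 0 * v 1 - u 1 * v 0 := by
    rcases sq_eq_sq_iff_eq_or_eq_neg.1 hsq with h0 | h0
    · exact ⟨v', hv', h0⟩
    · refine ⟨-v', by rw [quandleMap_neg, hv'], ?_⟩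
      rw [← neg_eq_iff_eq_neg] at h0
      rw [← h0, Pi.neg_apply, Pi.neg_apply]
      ring
  obtain ⟨A, hAu, hAv⟩ := exists_mulVec_eq hdet hdet'
  have hi : quandleMap u' = A * ρ (D.wirtinger i) * A⁻¹ := by rw [← hAu, quandleMap_mulVec, hu]
  have hj : quandleMap w = A * ρ (D.wirtinger j) * A⁻¹ := by rw [← hAv, quandleMap_mulVec, hv]
  refine ⟨A, fun g => ?_⟩
  have hconj : ∀ x, (ρ' x).1.trace = (A * ρ x * A⁻¹).1.trace := fun x => by
    rw [trace_mul_mul_inv, h]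
  have hmul : ∀ x y, A * ρ (x * y) * A⁻¹ = A * ρ x * A⁻¹ * (A * ρ y * A⁻¹) := fun x y => by
    rw [map_mul]; group
  refine eq_of_trace_mul_eq (hdet'.symm ▸ hdet) (hconj g) ?_ ?_ ?_ ?_
  · have := hconj (g * D.wirtinger i)
    rwa [hmul, map_mul, ← hi, ← hu'] at this
  · have := hconj (g * D.wirtinger j)
    rwa [hmul, map_mul, ← hj, ← hw] at this
  · have := hconj (g * (D.wirtinger i * D.wirtinger j))
    rwa [hmul, hmul, map_mul, map_mul, ← hi, ← hj, ← hw, ← hu'] at this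
  · have := hconj (g * (D.wirtinger j * D.wirtinger i))
    rwa [hmul, hmul, map_mul, map_mul, ← hi, ← hj, ← hw, ← hu'] at this

/-- Two sign-types of opposite total signs account for each parabolic representation once. The
quotient of the parabolic representations may be by any relation between conjugacy and equality of
characters, since those two relations agree. -/
theorem exists_bijective_quotient {ε₁ ε₂ : Fin N → ℤˣ} (h₁ : totalSign ε₁ = 1)
    (h₂ : totalSign ε₂ = -1) (r : Setoid D.ParRep) (hconj : D.conjSetoid ≤ r)
    (hchar : r ≤ D.charSetoid) :
    ∃ Φ : Quotient (D.leftMulSetoid (D.signedQuandleSystem ε₁ ∪ D.signedQuandleSystem ε₂)) →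
        Quotient r,
      (∀ a, Φ (Quotient.mk _ a) =
        Quotient.mk r (D.parRep a.1 (D.union_subset_quandleSystem ε₁ ε₂ a.2))) ∧
      Function.Bijective Φ := by
  refine ⟨Quotient.map (fun a => D.parRep a.1 (D.union_subset_quandleSystem ε₁ ε₂ a.2)) ?_,
    fun a => rfl, ?_, ?_⟩
  · rintro ⟨a, ha⟩ ⟨b, hb⟩ ⟨B, hB⟩
    apply hconj
    refine ⟨B, fun g => ?_⟩
    obtain ⟨ε, ha'⟩ : ∃ ε, a ∈ D.signedQuandleSystem ε := ha.elim (⟨_, ·⟩) (⟨_, ·⟩)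
    obtain ⟨hBa, h⟩ := D.exists_leftMul_mem ha' B
    change D.leftMul B a = b at hB
    subst hB
    exact DFunLike.congr_fun h g
  · intro x y
    refine Quotient.inductionOn₂ x y ?_
    rintro ⟨a, ha⟩ ⟨b, hb⟩ hab
    have hch := hchar (Quotient.exact hab)
    change ∀ g, (D.assocRep a (D.union_subset_quandleSystem ε₁ ε₂ ha).1 g).1.trace =
      (D.assocRep b (D.union_subset_quandleSystem ε₁ ε₂ hb).1 g).1.trace at hch
    have hob : ∀ {ε ε' : Fin N → ℤˣ} (_ : a ∈ D.signedQuandleSystem ε)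
        (_ : b ∈ D.signedQuandleSystem ε'), totalSign ε = totalSign ε' := by
      intro ε ε' ha' hb'
      apply intCast_units_injective
      rw [← D.obstructionClass_assocRep ha', ← D.obstructionClass_assocRep hb', obstructionClass,
        obstructionClass, hch]
    obtain ⟨ε, ha', hb'⟩ : ∃ ε, a ∈ D.signedQuandleSystem ε ∧ b ∈ D.signedQuandleSystem ε := by
      rcases ha with ha' | ha' <;> rcases hb with hb' | hb'
      · exact ⟨_, ha', hb'⟩
      · exact absurd (h₁.symm.trans ((hob ha' hb').trans h₂)) (by decide)
      · exact absurd (h₂.symm.trans ((hob ha' hb').trans h₁)) (by decide)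
      · exact ⟨_, ha', hb'⟩
    obtain ⟨A, hA⟩ := D.exists_conj_of_trace_eq ha'.1.2 hb'.1.2 hch
    obtain ⟨hAa, hAρ⟩ := D.exists_leftMul_mem ha' A
    have hAb : D.assocRep _ hAa.1.1 = D.assocRep b hb'.1.1 :=
      hAρ.trans (MonoidHom.ext fun g => (hA g).symm)
    apply Quotient.sound
    rcases (D.coloring_iff hb'.1.2 hAa hAb b).1 ⟨hb', rfl⟩ with h | h
    · exact ⟨A, h.symm⟩
    · exact ⟨-1 * A, by rw [leftMul_mul, leftMul_neg_one]; exact h.symm⟩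
  · intro x
    refine Quotient.inductionOn x ?_
    rintro ⟨ρ, hρ⟩
    have hex : ∃ a, ∃ ha : a ∈ D.signedQuandleSystem ε₁ ∪ D.signedQuandleSystem ε₂,
        D.assocRep a (D.union_subset_quandleSystem ε₁ ε₂ ha).1 = ρ := by
      obtain ⟨s, hs, -⟩ := hρ.obstructionClass_sign
      rcases Int.units_eq_one_or s with rfl | rfl
      · obtain ⟨a, ha, h⟩ := D.exists_coloring_of_obstructionClass (ε := ε₁) hρ (by rw [h₁, hs])
        exact ⟨a, Or.inl ha, h⟩
      · obtain ⟨a, ha, h⟩ := D.exists_coloring_of_obstructionClass (ε := ε₂) hρ (by rw [h₂, hs])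
        exact ⟨a, Or.inr ha, h⟩
    obtain ⟨a, ha, h⟩ := hex
    exact ⟨Quotient.mk _ ⟨a, ha⟩, congrArg (Quotient.mk r) (Subtype.ext h)⟩

end SignedGaussCode

theorem mainTheorem2 {N : ℕ} (D : KnotDiagram N) :
    -- the obstruction class of a parabolic representation is a sign, computed by any longitude
    (∀ ρ : D.KnotGroup →* SL(2, ℂ), D.IsParabolic ρ →
      (D.obstructionClass ρ = 1 ∨ D.obstructionClass ρ = -1) ∧
      ∀ l, D.IsLongitude l → (ρ l).1.trace = 2 * D.obstructionClass ρ) ∧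
    -- existence of an arc-coloring of the given sign-type, unique up to sign
    (∀ ρ : D.KnotGroup →* SL(2, ℂ), D.IsParabolic ρ →
      ∀ ob : ℤˣ, D.obstructionClass ρ = ((ob : ℤ) : ℂ) →
      ∀ ε : Fin N → ℤˣ, totalSign ε = ob →
        ∃ a : D.Arc → Fin 2 → ℂ, a ≠ -a ∧
          ∀ b : D.Arc → Fin 2 → ℂ,
            (∃ hb : b ∈ D.signedQuandleSystem ε, D.assocRep b hb.1.1 = ρ) ↔ (b = a ∨ b = -a)) ∧
    -- an arc-coloring of sign-type `ε` gives a representation of obstruction class `totalSign ε`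
    (∀ (ε : Fin N → ℤˣ) (a : D.Arc → Fin 2 → ℂ) (ha : a ∈ D.signedQuandleSystem ε),
      D.obstructionClass (D.assocRep a ha.1.1) = ((totalSign ε : ℤ) : ℂ)) ∧
    -- the action of `SL(2, ℂ)` preserves the sign-type
    (∀ (ε : Fin N → ℤˣ), ∀ a ∈ D.signedQuandleSystem ε, ∀ B : SL(2, ℂ),
      D.leftMul B a ∈ D.signedQuandleSystem ε) ∧
    -- the induced map on the quotient is well defined and bijective
    ∀ ε₁ ε₂ : Fin N → ℤˣ, totalSign ε₁ = 1 → totalSign ε₂ = -1 →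
      Disjoint (D.signedQuandleSystem ε₁) (D.signedQuandleSystem ε₂) ∧
      (∃ Φ : Quotient (D.leftMulSetoid (D.signedQuandleSystem ε₁ ∪ D.signedQuandleSystem ε₂)) →
            D.ConjClassesPar,
        (∀ a, Φ (Quotient.mk _ a) =
          Quotient.mk D.conjSetoid (D.parRep a.1 (D.union_subset_quandleSystem ε₁ ε₂ a.2))) ∧
        Function.Bijective Φ) ∧
      (∃ Ψ : Quotient (D.leftMulSetoid (D.signedQuandleSystem ε₁ ∪ D.signedQuandleSystem ε₂)) →
            D.CharsPar,
        (∀ a, Ψ (Quotient.mk _ a) =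
          Quotient.mk D.charSetoid (D.parRep a.1 (D.union_subset_quandleSystem ε₁ ε₂ a.2))) ∧
        Function.Bijective Ψ) := by
  refine ⟨fun ρ hρ => ?_, fun ρ hρ ob hob ε hε => ?_,
    fun ε a ha => D.toSignedGaussCode.obstructionClass_assocRep ha,
    fun ε a ha B => (D.toSignedGaussCode.exists_leftMul_mem ha B).1, fun ε₁ ε₂ h₁ h₂ =>
    ⟨?_, D.exists_bijective_quotient h₁ h₂ D.conjSetoid le_rfl ?_,
      D.exists_bijective_quotient h₁ h₂ D.charSetoid ?_ le_rfl⟩⟩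
  · obtain ⟨s, hs, hl⟩ := hρ.obstructionClass_sign
    refine ⟨?_, hl⟩
    rcases Int.units_eq_one_or s with rfl | rfl
    · exact Or.inl (by simpa using hs)
    · exact Or.inr (by simpa using hs)
  · subst hε
    obtain ⟨a, ha, haρ⟩ := D.exists_coloring_of_obstructionClass hρ hob
    refine ⟨a, fun hneg => ?_, D.coloring_iff hρ ha haρ⟩
    have h0 := congrFun hneg (D.arcOfEdge 0)
    exact hρ.ne_zero ((D.assocRep_eq_iff ha.1.1).1 haρ _) (self_eq_neg.1 h0)
  · rw [Set.disjoint_left]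
    intro a ha₁ ha₂
    have h := (D.obstructionClass_assocRep ha₁).symm.trans (D.obstructionClass_assocRep ha₂)
    have h' := intCast_units_injective h
    rw [h₁, h₂] at h'
    exact absurd h' (by decide)
  all_goals
    rintro ρ ρ' ⟨A, hA⟩ g
    rw [hA, trace_mul_mul_inv]
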